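/- For $k\in\mathbb N=\{0,1,2,\dots\}$, a \emph{$k$-graph} is a countable small category $\Lambda$ with a functor $d:\Lambda\to\mathbb N^k$ such that whenever $d(\lambda)=m+n$ there are unique $\mu,\nu\in\Lambda$ with $d(\mu)=m$, $d(\nu)=n$ and $\lambda=\mu\nu$; write $r,s$ for range and source, $\Lambda^0$ for the set of objects (identified with the paths of degree $0$), $v\Lambda$ and $\Lambda v$ for the sets of paths with range $v$, respectively source $v$. For $\lambda,\mu\in\Lambda$ let $\Lambda^{\min}(\lambda,\mu)$ be the set of pairs $(\rho,\tau)$ with $\lambda\rho=\mu\tau$ and $d(\lambda\rho)=d(\lambda)\vee d(\mu)$. $\Lambda$ is \emph{finitely aligned} if all $\Lambda^{\min}(\lambda,\mu)$ are finite. A set $E\subseteq v\Lambda$ is \emph{exhaustive} if for every $\lambda\in v\Lambda$ there is $\mu\in E$ with $\Lambda^{\min}(\lambda,\mu)\ne\emptyset$. For $m\in(\mathbb N\cup\{\infty\})^k$ let $\Omega_{k,m}$ be the category with objects $p\in\mathbb N^k$, $p\le m$, and one morphism $(p,q)$ of range $p$, source $q$ and degree $q-p$ for $p\le q\le m$. A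 \emph{boundary path} is a degree-preserving functor $x:\Omega_{k,m}\to\Lambda$ such that for all $n\in\mathbb N^k$ with $n\le m$ and all finite exhaustive $E\subseteq x(n,n)\Lambda$ there is $\lambda\in E$ with $n+d(\lambda)\le m$ and $x(n,n+d(\lambda))=\lambda$. Put $d(x)=m$, $r(x)=x(0,0)$, and for $n\in\mathbb N^k$ with $n\le d(x)$ let $\sigma^n(x)$ be the boundary path of degree $d(x)-n$ given by $\sigma^n(x)(p,q)=x(p+n,q+n)$; an equation involving $\sigma^n(x)$ always includes the condition $n\le d(x)$. For $\lambda\in\Lambda$ and a boundary path $x$ with $r(x)=s(\lambda)$, $\lambda x$ denotes the boundary path $y$ with $\sigma^{d(\lambda)}(y)=x$ and $y(0,d(\lambda))=\lambda$. The set $\partial\Lambda$ of boundary paths carries the topology generated by the sets $Z(\lambda\setminus G)=Z(\lambda)\setminus\bigcup_{\nu\in G}Z(\lambda\nu)$, where $Z(\lambda)=\{\lambda x: x\in\partial\Lambda,\ r(x)=s(\lambda)\}$ and $G\subseteq s(\lambda)\Lambda$ is finite and not exhaustive. Put $\partial\Lambda^{\ge m}=\{x\in\partial\Lambda: d(x)\ge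 m\}$. The \emph{orbit} of $x$ is $\operatorname{orb}(x)=\{y\in\partial\Lambda:\sigma^n(y)=\sigma^m(x)\text{ for some }m,n\in\mathbb N^k\}$ and $\operatorname{Per}(x)=\{m-n: m,n\in\mathbb N^k,\ \sigma^m(x)=\sigma^n(x)\}\subseteq\mathbb Z^k$. $\Lambda$ is \emph{aperiodic} if for each $v\in\Lambda^0$ there is $x\in\partial\Lambda$ with $r(x)=v$ such that $\lambda x\neq\mu x$ for all distinct $\lambda,\mu\in\Lambda v$. Let $\Lambda_1$ be a finitely aligned $k_1$-graph and $\Lambda_2$ a finitely aligned $k_2$-graph. A \emph{continuous orbit equivalence} is a homeomorphism $h:\partial\Lambda_1\to\partial\Lambda_2$ with $h(\operatorname{orb}(x))=\operatorname{orb}(h(x))$ for all $x\in\partial\Lambda_1$ that has a \emph{family of continuous cocycles}, i.e. continuous maps $f_m,g_m:\partial\Lambda_1^{\ge m}\to\mathbb N^{k_2}$ ($m\in\mathbb N^{k_1}$) and $i_m,j_m:\partial\Lambda_2^{\ge m}\to\mathbb N^{k_1}$ ($m\in\mathbb N^{k_2}$) such that $$\sigma^{f_m(x)}(h(\sigma^m(x)))=\sigma^{g_m(x)}(h(x))\quad(x\in\partial\Lambda_1^{\ge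 m}),$$ $$(g_{m+n}-f_{m+n})(x)=(g_m-f_m)(x)+(g_n-f_n)(\sigma^m(x))\quad(x\in\partial\Lambda_1^{\ge m+n}),$$ and such that $i_m,j_m$ satisfy the same two conditions with $h^{-1}$ in place of $h$ ($i$ in the role of $f$, $j$ in the role of $g$). It is \emph{period-preserving} if it has a family of continuous cocycles such that $$\{g_m(x)-f_m(x)-g_n(x)+f_n(x): m,n\in\mathbb N^{k_1},\ \sigma^m(x)=\sigma^n(x)\}=\operatorname{Per}(h(x))\quad\text{for all }x\in\partial\Lambda_1,$$ $$\{j_m(x)-i_m(x)-j_n(x)+i_n(x): m,n\in\mathbb N^{k_2},\ \sigma^m(x)=\sigma^n(x)\}=\operatorname{Per}(h^{-1}(x))\quad\text{for all }x\in\partial\Lambda_2.$$ \textbf{Statement.} If $\Lambda_1$ and $\Lambda_2$ are aperiodic finitely aligned higher-rank graphs (of possibly different ranks $k_1,k_2$), then every continuous orbit equivalence $h:\partial\Lambda_1\to\partial\Lambda_2$ is period-preserving. -/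

import Mathlib

open CategoryTheory

universe u v u₁ v₁ u₂ v₂

/-- A morphism of the category `V`, with source and range not fixed in advance. -/
structure CatPath (V : Type u) [Category.{v} V] where
  {s : V}
  {r : V}
  hom : s ⟶ r

namespace CatPath

variable {V : Type u} [Category.{v} V]

/-- The identity morphism at a vertex. -/
def id (a : V) : CatPath V := ⟨𝟙 a⟩

/-- The product `lam mu`, defined when `s(lam) = r(mu)`: first `mu`, then `lam`. -/
def comp (lam mu : CatPath V) (h : lam.s = mu.r) : CatPath V :=
  ⟨mu.hom ≫ eqToHom h.symm ≫ lam.hom⟩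

end CatPath

/-- A higher-rank graph of rank `k`: a category with countably many morphisms, together with a
degree functor to the monoid `ℕ^k` that has the factorisation property. -/
structure HigherRankGraph (k : ℕ) where
  /-- the objects (vertices) -/
  V : Type u
  [cat : Category.{v} V]
  countable : Countable (CatPath V)
  /-- the degree functor -/
  degree : ∀ {a b : V}, (a ⟶ b) → (Fin k → ℕ)
  degree_id : ∀ a : V, degree (𝟙 a) = 0
  degree_comp : ∀ {a b c : V} (f : a ⟶ b) (g : b ⟶ c), degree (f ≫ g) = degree f + degree g
  factorisation : ∀ (lam : CatPath V) (m n : Fin k → ℕ), degree lam.hom = m + n →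
    ∃! p : CatPath V × CatPath V, degree p.1.hom = m ∧ degree p.2.hom = n ∧
      ∃ h : p.1.s = p.2.r, p.1.comp p.2 h = lam

attribute [instance] HigherRankGraph.cat

namespace HigherRankGraph

variable {k : ℕ} (Λ : HigherRankGraph.{u, v} k)

/-- The paths (morphisms) of `Λ`. -/
abbrev Path : Type (max u v) := CatPath Λ.V

variable {Λ}

/-- The degree of a path. -/
def deg (lam : Λ.Path) : Fin k → ℕ := Λ.degree lam.hom

/-- `τ(0, d(lam)) = lam`. -/
def IsInitialSegment (lam τ : Λ.Path) : Prop :=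
  ∃ (ν : Λ.Path) (h : lam.s = ν.r), lam.comp ν h = τ

/-- The minimal common extensions of two paths. -/
def MCE (lam mu : Λ.Path) : Set Λ.Path :=
  {τ | deg τ = deg lam ⊔ deg mu ∧ IsInitialSegment lam τ ∧ IsInitialSegment mu τ}

/-- `Λ^min(lam, mu)`. -/
def minExt (lam mu : Λ.Path) : Set (Λ.Path × Λ.Path) :=
  {p | ∃ (h : lam.s = p.1.r) (h' : mu.s = p.2.r),
    lam.comp p.1 h = mu.comp p.2 h' ∧ lam.comp p.1 h ∈ MCE lam mu}

variable (Λ) in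
def FinitelyAligned : Prop := ∀ lam mu : Λ.Path, (minExt lam mu).Finite

/-- `E` is an exhaustive subset of `vΛ`. -/
def Exhaustive (a : Λ.V) (E : Set Λ.Path) : Prop :=
  (∀ mu ∈ E, mu.r = a) ∧ ∀ lam : Λ.Path, lam.r = a → ∃ mu ∈ E, (minExt lam mu).Nonempty

/-- The order relation between `q ∈ ℕ^k` and `m ∈ (ℕ ∪ {∞})^k`. -/
def LeDeg (q : Fin k → ℕ) (m : Fin k → ℕ∞) : Prop := ∀ i, (q i : ℕ∞) ≤ m i

theorem LeDeg.of_le {p q : Fin k → ℕ} {m : Fin k → ℕ∞} (hq : LeDeg q m) (h : p ≤ q) : LeDeg p m :=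
  fun i => (Nat.cast_le.2 (h i)).trans (hq i)

theorem LeDeg.add_of_sub {p m : Fin k → ℕ} {M : Fin k → ℕ∞} (hm : LeDeg m M)
    (hp : LeDeg p (fun i => M i - m i)) : LeDeg (p + m) M := fun i => by
  have h := add_le_add_left (hp i) (m i : ℕ∞)
  rw [tsub_add_cancel_of_le (hm i)] at h
  simpa using h

theorem LeDeg.sub {p m : Fin k → ℕ} {M : Fin k → ℕ∞} (h : LeDeg (p + m) M) :
    LeDeg p (fun i => M i - m i) := fun i => by
  have := h i
  simp only [Pi.add_apply, Nat.cast_add] at this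
  exact ENat.le_sub_of_add_le_right (ENat.natCast_ne_top _) this

variable (Λ) in
/-- A boundary path of `Λ`: a degree-preserving functor `x : Ω_{k,m} → Λ` (`vertex` is its object
map, `path p q` its value at the morphism `(p, q)`), such that for every `n ≤ m` and every finite
exhaustive `E ⊆ x(n,n)Λ` there is `lam ∈ E` with `x(n, n + d(lam)) = lam`. -/
structure BoundaryPath where
  /-- the degree `m ∈ (ℕ ∪ {∞})^k` -/
  degree : Fin k → ℕ∞
  vertex : ∀ p : Fin k → ℕ, LeDeg p degree → Λ.V
  path : ∀ p q : Fin k → ℕ, p ≤ q → LeDeg q degree → Λ.Path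
  path_r : ∀ p q (h : p ≤ q) (hq : LeDeg q degree), (path p q h hq).r = vertex p (hq.of_le h)
  path_s : ∀ p q (h : p ≤ q) (hq : LeDeg q degree), (path p q h hq).s = vertex q hq
  path_id : ∀ p (hp : LeDeg p degree), path p p le_rfl hp = CatPath.id (vertex p hp)
  path_comp : ∀ p q t (h : p ≤ q) (h' : q ≤ t) (ht : LeDeg t degree),
    (path p q h (ht.of_le h')).comp (path q t h' ht) ((path_s _ _ _ _).trans (path_r _ _ _ _).symm)
      = path p t (h.trans h') ht
  path_deg : ∀ p q (h : p ≤ q) (hq : LeDeg q degree), deg (path p q h hq) = q - p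
  boundary : ∀ n (hn : LeDeg n degree) (E : Set Λ.Path), E.Finite → Exhaustive (vertex n hn) E →
    ∃ lam ∈ E, ∃ h : LeDeg (n + deg lam) degree, path n (n + deg lam) le_self_add h = lam

namespace BoundaryPath

/-- The range `r(x) = x(0,0)`. -/
def r (x : Λ.BoundaryPath) : Λ.V := x.vertex 0 (fun _ => by simp)

theorem path_congr (x : Λ.BoundaryPath) {p q p' q' : Fin k → ℕ} (hp : p = p') (hq : q = q')
    (h : p ≤ q) (h' : LeDeg q x.degree) :
    x.path p q h h' = x.path p' q' (hp ▸ hq ▸ h) (hq ▸ h') := by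
  subst hp hq; rfl

/-- The shift `σ^m(x)`, defined for `m ≤ d(x)`. -/
def shift (x : Λ.BoundaryPath) (m : Fin k → ℕ) (hm : LeDeg m x.degree) : Λ.BoundaryPath where
  degree := fun i => x.degree i - m i
  vertex p hp := x.vertex (p + m) (hm.add_of_sub hp)
  path p q h hq := x.path (p + m) (q + m) (add_le_add_left h m) (hm.add_of_sub hq)
  path_r _ _ _ _ := x.path_r _ _ _ _
  path_s _ _ _ _ := x.path_s _ _ _ _
  path_id _ _ := x.path_id _ _
  path_comp _ _ _ _ _ _ := x.path_comp _ _ _ _ _ _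
  path_deg p q h hq := by
    rw [x.path_deg]; funext i; simp only [Pi.sub_apply, Pi.add_apply]; omega
  boundary n hn E hE hex := by
    obtain ⟨lam, hl, h, e⟩ := x.boundary _ _ E hE hex
    have e1 : n + m + deg lam = n + deg lam + m := add_right_comm _ _ _
    refine ⟨lam, hl, LeDeg.sub (e1 ▸ h), ?_⟩
    rw [x.path_congr rfl e1] at e
    exact e

/-- `y = lam x`, i.e. `σ^{d(lam)}(y) = x` and `y(0, d(lam)) = lam`. -/
def IsConcat (lam : Λ.Path) (x y : Λ.BoundaryPath) : Prop :=
  ∃ h : LeDeg (deg lam) y.degree, y.shift (deg lam) h = x ∧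
    y.path 0 (deg lam) (fun _ => Nat.zero_le _) h = lam

/-- The cylinder set `Z(lam) = {lam x : x ∈ s(lam)∂Λ}`. -/
def cylinder (lam : Λ.Path) : Set Λ.BoundaryPath :=
  {y | ∃ x : Λ.BoundaryPath, x.r = lam.s ∧ IsConcat lam x y}

/-- The set `Z(lam \ G)`, for `G ⊆ s(lam)Λ`. -/
def cylinderDiff (lam : Λ.Path) (G : Set Λ.Path) : Set Λ.BoundaryPath :=
  cylinder lam \ ⋃ (ν ∈ G) (h : lam.s = ν.r), cylinder (lam.comp ν h)

/-- The topology generated by the sets `Z(lam \ G)`, `G ⊆ s(lam)Λ` finite and not exhaustive. -/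
instance : TopologicalSpace Λ.BoundaryPath :=
  TopologicalSpace.generateFrom
    {U | ∃ (lam : Λ.Path) (G : Set Λ.Path), G.Finite ∧ (∀ ν ∈ G, ν.r = lam.s) ∧
      ¬ Exhaustive lam.s G ∧ U = cylinderDiff lam G}

/-- The orbit of `x`. -/
def orbit (x : Λ.BoundaryPath) : Set Λ.BoundaryPath :=
  {y | ∃ (n m : Fin k → ℕ) (hn : LeDeg n y.degree) (hm : LeDeg m x.degree),
    y.shift n hn = x.shift m hm}

/-- The periodicity group of `x`. -/
def per (x : Λ.BoundaryPath) : Set (Fin k → ℤ) :=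
  {l | ∃ (m n : Fin k → ℕ) (hm : LeDeg m x.degree) (hn : LeDeg n x.degree),
    x.shift m hm = x.shift n hn ∧ l = fun i => (m i : ℤ) - n i}

end BoundaryPath

variable (Λ) in
/-- The space `∂Λ^{≥ m}` of boundary paths of degree at least `m`. -/
abbrev BoundaryPathGE (m : Fin k → ℕ) : Type (max u v) := {x : Λ.BoundaryPath // LeDeg m x.degree}

variable (Λ) in
/-- Every vertex `v` is the range of a boundary path `x` such that `lam x ≠ mu x` for all
`lam ≠ mu` in `Λv`. -/
def Aperiodic : Prop :=
  ∀ a : Λ.V, ∃ x : Λ.BoundaryPath, x.r = a ∧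
    ∀ lam mu : Λ.Path, lam.s = a → mu.s = a → lam ≠ mu →
      ∀ y z : Λ.BoundaryPath, BoundaryPath.IsConcat lam x y → BoundaryPath.IsConcat mu x z → y ≠ z

variable {k₁ k₂ : ℕ} {Λ₁ : HigherRankGraph.{u₁, v₁} k₁} {Λ₂ : HigherRankGraph.{u₂, v₂} k₂}

def IsOrbitEquivalence (h : Λ₁.BoundaryPath ≃ₜ Λ₂.BoundaryPath) : Prop :=
  ∀ x : Λ₁.BoundaryPath, h '' x.orbit = (h x).orbit

/-- The integer vector `g_m(x) - f_m(x)`. -/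
def lag (f g : ∀ m : Fin k₁ → ℕ, Λ₁.BoundaryPathGE m → (Fin k₂ → ℕ))
    (m : Fin k₁ → ℕ) (x : Λ₁.BoundaryPathGE m) : Fin k₂ → ℤ :=
  fun i => (g m x i : ℤ) - f m x i

/-- The half of the definition of a family of continuous cocycles for `h` that concerns the
functions `f_m, g_m : ∂Λ₁^{≥ m} → ℕ^{k₂}`; the other half is the same for `h⁻¹`. -/
structure IsCocyclePair (h : Λ₁.BoundaryPath ≃ₜ Λ₂.BoundaryPath)
    (f g : ∀ m : Fin k₁ → ℕ, Λ₁.BoundaryPathGE m → (Fin k₂ → ℕ)) : Prop where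
  continuous_f : ∀ m, Continuous (f m)
  continuous_g : ∀ m, Continuous (g m)
  orbit_eq : ∀ m (x : Λ₁.BoundaryPathGE m),
    ∃ (hf : LeDeg (f m x) (h (x.1.shift m x.2)).degree) (hg : LeDeg (g m x) (h x.1).degree),
      (h (x.1.shift m x.2)).shift (f m x) hf = (h x.1).shift (g m x) hg
  cocycle : ∀ (m n : Fin k₁ → ℕ) (x : Λ₁.BoundaryPath) (hmn : LeDeg (m + n) x.degree)
    (hm : LeDeg m x.degree) (hn : LeDeg n (x.shift m hm).degree),
    lag f g (m + n) ⟨x, hmn⟩ = lag f g m ⟨x, hm⟩ + lag f g n ⟨x.shift m hm, hn⟩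

/-- For every `x`, the vectors `g_m(x) - f_m(x) - g_n(x) + f_n(x)` with `σ^m(x) = σ^n(x)` are
exactly the elements of `Per(h(x))`. -/
def PreservesPeriods (h : Λ₁.BoundaryPath ≃ₜ Λ₂.BoundaryPath)
    (f g : ∀ m : Fin k₁ → ℕ, Λ₁.BoundaryPathGE m → (Fin k₂ → ℕ)) : Prop :=
  ∀ x : Λ₁.BoundaryPath,
    {l | ∃ (m n : Fin k₁ → ℕ) (hm : LeDeg m x.degree) (hn : LeDeg n x.degree),
      x.shift m hm = x.shift n hn ∧ l = lag f g m ⟨x, hm⟩ - lag f g n ⟨x, hn⟩} = (h x).per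

def IsContinuousOrbitEquivalence (h : Λ₁.BoundaryPath ≃ₜ Λ₂.BoundaryPath) : Prop :=
  IsOrbitEquivalence h ∧ ∃ f g i j, IsCocyclePair h f g ∧ IsCocyclePair h.symm i j

/-- `h` is a continuous orbit equivalence that has a family of continuous cocycles which is
compatible with the periodicity groups. -/
def IsPeriodPreserving (h : Λ₁.BoundaryPath ≃ₜ Λ₂.BoundaryPath) : Prop :=
  IsOrbitEquivalence h ∧ ∃ f g i j, IsCocyclePair h f g ∧ IsCocyclePair h.symm i j ∧
    PreservesPeriods h f g ∧ PreservesPeriods h.symm i j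

end HigherRankGraph

/-! Every family of continuous cocycles of `h` already matches the periods, so no new family has to
be built. If σ^m(x) = σ^n(x), the cocycles at m and n relate two shifts of h(x) to each other, with
exponents differing by lag_m(x) - lag_n(x) (`IsCocyclePair.shiftEq`). This gives one inclusion.

Conversely, let y = h(x) and σ^a(y) = σ^b(y). The cocycles of h⁻¹ turn this into σ^M(x) = σ^N(x),
and those of h turn that back into σ^A(y) = σ^B(y) with A - B = lag_M(x) - lag_N(x). It remains to
see that A - B = a - b, which the possibly periodic point y alone cannot decide. So the relation is
spread to a neighbourhood: exchanging the initial segment y(0,a) for y(0,b) gives a map φ, tending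
to y at y, with σ^a(z) = σ^b(φ(z)) for z near y (`exists_tendsto_shift_eq`). Cocycles are locally
constant, so the same round trip gives σ^A(z) = σ^B(φ(z)) near y. Eliminating φ(z) makes two shifts
agree on an open set, and aperiodicity of the target graph forces their exponents to be equal
(`eq_of_forall_shift_eq`). -/

namespace HigherRankGraph

/-! ### Composition and factorisation of paths -/

variable {k : ℕ} {Λ : HigherRankGraph.{u, v} k}

/-- `τ` is the product `α β`. -/
def IsComp (α β τ : Λ.Path) : Prop := ∃ h : α.s = β.r, α.comp β h = τ

theorem exists_isComp {α β : Λ.Path} (h : α.s = β.r) : ∃ τ, IsComp α β τ := ⟨_, h, rfl⟩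

namespace IsComp

variable {α β γ δ τ ε α' β' : Λ.Path}

theorem source_eq (h : IsComp α β τ) : τ.s = β.s := by
  obtain ⟨_, rfl⟩ := h; rfl

theorem range_eq (h : IsComp α β τ) : τ.r = α.r := by
  obtain ⟨_, rfl⟩ := h; rfl

theorem deg_eq (h : IsComp α β τ) : deg τ = deg α + deg β := by
  obtain ⟨h, rfl⟩ := h
  obtain @⟨a, b, f⟩ := α
  obtain @⟨c, d, g⟩ := β
  dsimp only at h
  subst h
  simp [deg, CatPath.comp, Λ.degree_comp, add_comm]

theorem unique (h : IsComp α β τ) (h' : IsComp α β ε) : τ = ε := by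
  obtain ⟨_, rfl⟩ := h
  obtain ⟨_, rfl⟩ := h'
  rfl

theorem assoc (h : IsComp α β τ) (h' : IsComp τ γ δ) : ∃ ε, IsComp β γ ε ∧ IsComp α ε δ := by
  obtain ⟨h, rfl⟩ := h
  obtain ⟨h', rfl⟩ := h'
  refine ⟨_, ⟨h', rfl⟩, h, ?_⟩
  obtain @⟨a, b, f⟩ := α
  obtain @⟨c, d, g⟩ := β
  obtain @⟨e, i, j⟩ := γ
  dsimp only [CatPath.comp] at h h'
  subst h h'
  simp only [CatPath.comp, eqToHom_refl, Category.id_comp, Category.assoc]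
  exact congrArg (fun t => CatPath.mk (j ≫ t))
    ((congrArg (g ≫ ·) (Category.id_comp f)).trans (Category.id_comp (g ≫ f)).symm)

theorem assoc_symm (h : IsComp β γ ε) (h' : IsComp α ε δ) :
    ∃ τ, IsComp α β τ ∧ IsComp τ γ δ := by
  obtain ⟨τ, hτ⟩ := exists_isComp (α := α) (β := β) (h'.1.trans h.range_eq)
  obtain ⟨ω, hω⟩ := exists_isComp (α := τ) (β := γ) (hτ.source_eq.trans h.1)
  obtain ⟨ε', h1, h2⟩ := hτ.assoc hω
  obtain rfl := h1.unique h
  obtain rfl := h2.unique h'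
  exact ⟨τ, hτ, hω⟩

/-- Degrees cancel in ℕ^k, so the right factors also have equal degree and uniqueness of
factorisations applies. -/
theorem cancel (h : IsComp α β τ) (h' : IsComp α' β' τ) (hd : deg α = deg α') :
    α = α' ∧ β = β' := by
  have e1 := h.deg_eq
  have e2 := h'.deg_eq
  rw [e1, ← hd] at e2
  have hb : deg β = deg β' := add_left_cancel e2
  obtain ⟨p, -, hp⟩ := Λ.factorisation τ _ _ e1
  have h1 := hp (α, β) ⟨rfl, rfl, h⟩
  have h2 := hp (α', β') ⟨hd.symm, hb.symm, h'⟩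
  exact Prod.ext_iff.1 (h1.trans h2.symm)

theorem factor (h : IsComp α β τ) (h' : IsComp α' β' τ) (hd : deg α ≤ deg α') :
    ∃ γ, IsComp α γ α' ∧ IsComp γ β' β := by
  obtain ⟨p, ⟨hp, -, hc⟩, -⟩ := Λ.factorisation α' (deg α) (deg α' - deg α)
    (by simpa [deg] using (add_tsub_cancel_of_le hd).symm)
  have hc : IsComp p.1 p.2 α' := hc
  obtain ⟨ε, h1, h2⟩ := hc.assoc h'
  obtain ⟨rfl, rfl⟩ := h2.cancel h hp
  exact ⟨_, hc, h1⟩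

theorem id_left (τ : Λ.Path) : IsComp (CatPath.id τ.r) τ τ := by
  refine ⟨rfl, ?_⟩
  simp [CatPath.comp, CatPath.id]

theorem id_right (τ : Λ.Path) : IsComp τ (CatPath.id τ.s) τ := by
  refine ⟨rfl, ?_⟩
  simp [CatPath.comp, CatPath.id]

end IsComp

theorem deg_id (a : Λ.V) : deg (CatPath.id a : Λ.Path) = 0 := Λ.degree_id a

theorem IsComp.eq_of_deg_left {α β τ : Λ.Path} (h : IsComp α β τ) (hd : deg α = 0) : β = τ :=
  (h.cancel (.id_left τ) (hd.trans (deg_id _).symm)).2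

theorem IsComp.eq_of_deg_right {α β τ : Λ.Path} (h : IsComp α β τ) (hd : deg β = 0) : α = τ :=
  (h.cancel (.id_right τ) (by rw [h.deg_eq, hd, add_zero])).1

theorem exists_factor (τ : Λ.Path) {m : Fin k → ℕ} (h : m ≤ deg τ) :
    ∃ α β, IsComp α β τ ∧ deg α = m := by
  obtain ⟨p, ⟨hp, -, hc⟩, -⟩ := Λ.factorisation τ m (deg τ - m)
    (by simpa [deg] using (add_tsub_cancel_of_le h).symm)
  exact ⟨_, _, hc, hp⟩

/-! ### Minimal common extensions and exhaustive sets -/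

/-- Two paths with a common extension have a minimal common extension below it. -/
theorem exists_minExt {α β α' β' τ : Λ.Path} (h : IsComp α α' τ) (h' : IsComp β β' τ) :
    ∃ p ∈ minExt α β, ∃ τ' γ, IsComp α p.1 τ' ∧ IsComp β p.2 τ' ∧ IsComp τ' γ τ ∧
      deg τ' = deg α ⊔ deg β := by
  obtain ⟨τ', γ, hc, hd⟩ := exists_factor τ (m := deg α ⊔ deg β)
    (sup_le (h.deg_eq ▸ le_self_add) (h'.deg_eq ▸ le_self_add))
  obtain ⟨ρ, h1, -⟩ := h.factor hc (hd ▸ le_sup_left)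
  obtain ⟨σ, h2, -⟩ := h'.factor hc (hd ▸ le_sup_right)
  refine ⟨(ρ, σ), ⟨h1.1, h2.1, h1.2.trans h2.2.symm, ?_⟩, τ', γ, h1, h2, hc, hd⟩
  rw [h1.2]
  exact ⟨hd, ⟨_, h1⟩, ⟨_, h2⟩⟩

theorem isComp_of_mem_minExt {α β : Λ.Path} {p : Λ.Path × Λ.Path} (h : p ∈ minExt α β) :
    ∃ τ, IsComp α p.1 τ ∧ IsComp β p.2 τ := by
  obtain ⟨h1, h2, e, -⟩ := h
  exact ⟨_, ⟨h1, rfl⟩, ⟨h2, e.symm⟩⟩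

/-- The paths `ρ` such that `μρ` is a minimal common extension of `μ` and an element of `E`. -/
def ext (μ : Λ.Path) (E : Set Λ.Path) : Set Λ.Path := ⋃ ε ∈ E, Prod.fst '' minExt μ ε

theorem mem_ext {μ ρ : Λ.Path} {E : Set Λ.Path} :
    ρ ∈ ext μ E ↔ ∃ ε ∈ E, ∃ σ, (ρ, σ) ∈ minExt μ ε := by
  simp [ext]

theorem finite_ext (fa : Λ.FinitelyAligned) (μ : Λ.Path) {E : Set Λ.Path} (hE : E.Finite) :
    (ext μ E).Finite :=
  hE.biUnion fun ε _ => (fa μ ε).image _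

theorem range_of_mem_ext {μ ρ : Λ.Path} {E : Set Λ.Path} (h : ρ ∈ ext μ E) : ρ.r = μ.s := by
  obtain ⟨ε, -, σ, h⟩ := mem_ext.1 h
  obtain ⟨τ, h1, -⟩ := isComp_of_mem_minExt h
  exact h1.1.symm

/-- For ζ starting at s(μ), the path μζ has a common extension with some ε in E. That extension
passes through a minimal common extension μρ of μ and ε, so cancelling μ leaves a common extension
of ζ and ρ. -/
theorem exhaustive_ext {μ : Λ.Path} {E : Set Λ.Path} (hE : Exhaustive μ.r E) :
    Exhaustive μ.s (ext μ E) := by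
  refine ⟨fun ρ hρ => range_of_mem_ext hρ, fun ζ hζ => ?_⟩
  obtain ⟨ω, hω⟩ := exists_isComp hζ.symm
  obtain ⟨ε, hε, p, hp⟩ := hE.2 ω hω.range_eq
  obtain ⟨τ, h1, h2⟩ := isComp_of_mem_minExt hp
  obtain ⟨η, h3, h4⟩ := hω.assoc h1
  obtain ⟨q, hq, τ', γ, h5, -, h7, -⟩ := exists_minExt h4 h2
  obtain ⟨η', h8, h9⟩ := h5.assoc h7
  obtain ⟨-, rfl⟩ := h9.cancel h4 rfl
  obtain ⟨q', hq', -⟩ := exists_minExt h3 h8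
  exact ⟨q.1, mem_ext.2 ⟨ε, hε, q.2, hq⟩, q', hq'⟩

theorem LeDeg.sup {m n : Fin k → ℕ} {M : Fin k → ℕ∞} (hm : LeDeg m M) (hn : LeDeg n M) :
    LeDeg (m ⊔ n) M := fun i => by
  rcases le_total (m i) (n i) with h | h
  · simpa [h] using hn i
  · simpa [h] using hm i

/-! ### Boundary paths, shifts and initial segments -/

namespace BoundaryPath

variable {x y z : Λ.BoundaryPath}

theorem isComp_path (x : Λ.BoundaryPath) {p q t : Fin k → ℕ} (h : p ≤ q) (h' : q ≤ t)
    (ht : LeDeg t x.degree) :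
    IsComp (x.path p q h (ht.of_le h')) (x.path q t h' ht) (x.path p t (h.trans h') ht) :=
  ⟨_, x.path_comp _ _ _ _ _ _⟩

theorem path_range (x : Λ.BoundaryPath) {q : Fin k → ℕ} (h : 0 ≤ q) (hq : LeDeg q x.degree) :
    (x.path 0 q h hq).r = x.r := x.path_r _ _ _ _

theorem deg_path_zero (x : Λ.BoundaryPath) {q : Fin k → ℕ} (h : 0 ≤ q) (hq : LeDeg q x.degree) :
    deg (x.path 0 q h hq) = q := by
  rw [x.path_deg, tsub_zero]

theorem ext_path (hd : x.degree = y.degree)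
    (hp : ∀ q (hx : LeDeg q x.degree) (hy : LeDeg q y.degree),
      x.path 0 q zero_le hx = y.path 0 q zero_le hy) : x = y := by
  have hpath : ∀ p q h (hx : LeDeg q x.degree) (hy : LeDeg q y.degree),
      x.path p q h hx = y.path p q h hy := by
    intro p q h hx hy
    have h1 := x.isComp_path zero_le h hx
    have h2 := y.isComp_path zero_le h hy
    rw [hp q hx hy] at h1
    exact (h1.cancel h2 (by rw [deg_path_zero, deg_path_zero])).2
  have hvertex : ∀ p (hx : LeDeg p x.degree) (hy : LeDeg p y.degree),
      x.vertex p hx = y.vertex p hy := by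
    intro p hx hy
    rw [← x.path_r p p le_rfl hx, ← y.path_r p p le_rfl hy, hpath]
  obtain ⟨d, v, P⟩ := x
  obtain ⟨d', v', P'⟩ := y
  dsimp only at hd
  subst hd
  obtain rfl : v = v' := by funext p h; exact hvertex p h h
  obtain rfl : P = P' := by funext p q h h'; exact hpath p q h h' h'
  rfl

/-- A boundary path can be given by its initial segments alone: the segment from p to q is the
unique ν with P(p)ν = P(q), and functoriality follows by cancellation. -/
theorem exists_of_prefixes (D : Fin k → ℕ∞) (P : ∀ q, LeDeg q D → Λ.Path)
    (hdeg : ∀ q h, deg (P q h) = q)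
    (hmono : ∀ p q (h : p ≤ q) (hq : LeDeg q D), ∃ ν, IsComp (P p (hq.of_le h)) ν (P q hq))
    (hb : ∀ n hn (E : Set Λ.Path), E.Finite → Exhaustive (P n hn).s E →
      ∃ lam ∈ E, ∃ h : LeDeg (n + deg lam) D, IsComp (P n hn) lam (P _ h)) :
    ∃ y : Λ.BoundaryPath, y.degree = D ∧ ∀ q hq hq', y.path 0 q zero_le hq = P q hq' := by
  choose Q hQ using hmono
  have hQdeg : ∀ p q h hq, deg (Q p q h hq) = q - p := by
    intro p q h hq
    have := (hQ p q h hq).deg_eq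
    rw [hdeg, hdeg] at this
    exact (tsub_eq_of_eq_add_rev this).symm
  have hQid : ∀ p hp, Q p p le_rfl hp = CatPath.id (P p hp).s := fun p hp =>
    ((hQ p p le_rfl hp).cancel (.id_right _) rfl).2
  have hQcomp : ∀ p q t (h : p ≤ q) (h' : q ≤ t) (ht : LeDeg t D),
      IsComp (Q p q h (ht.of_le h')) (Q q t h' ht) (Q p t (h.trans h') ht) := by
    intro p q t h h' ht
    obtain ⟨ε, h1, h2⟩ := (hQ p q h _).assoc (hQ q t h' ht)
    obtain ⟨-, rfl⟩ := h2.cancel (hQ p t (h.trans h') ht) rfl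
    exact h1
  refine ⟨{ degree := D
            vertex := fun p hp => (P p hp).s
            path := Q
            path_r := fun p q h hq => (hQ p q h hq).1.symm
            path_s := fun p q h hq => (hQ p q h hq).source_eq.symm
            path_id := hQid
            path_comp := fun p q t h h' ht => (hQcomp p q t h h' ht).2
            path_deg := hQdeg
            boundary := ?_ }, rfl, ?_⟩
  · intro n hn E hE hex
    obtain ⟨lam, hl, h, hc⟩ := hb n hn E hE hex
    exact ⟨lam, hl, h, ((hQ n _ le_self_add h).cancel hc rfl).2⟩
  · intro q hq hq'
    exact (hQ 0 q zero_le hq).eq_of_deg_left (hdeg _ _)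

theorem shift_path (x : Λ.BoundaryPath) (m : Fin k → ℕ) (hm : LeDeg m x.degree)
    (p q : Fin k → ℕ) (h : p ≤ q) (hq : LeDeg q (x.shift m hm).degree) :
    (x.shift m hm).path p q h hq =
      x.path (p + m) (q + m) (add_le_add_left h m) (hm.add_of_sub hq) := rfl

theorem shift_shift (x : Λ.BoundaryPath) {m n : Fin k → ℕ} (hm : LeDeg m x.degree)
    (hn : LeDeg n (x.shift m hm).degree) (hmn : LeDeg (m + n) x.degree) :
    (x.shift m hm).shift n hn = x.shift (m + n) hmn := by
  refine ext_path ?_ ?_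
  · funext i
    simp [shift, tsub_tsub]
  · intro q hx hy
    simp only [shift_path]
    exact x.path_congr (by abel) (by abel) _ _

/-- `lam` is an initial segment of the boundary path `x`. -/
def IsPrefix (lam : Λ.Path) (x : Λ.BoundaryPath) : Prop :=
  ∃ h : LeDeg (deg lam) x.degree, x.path 0 (deg lam) zero_le h = lam

theorem isPrefix_path (x : Λ.BoundaryPath) {n : Fin k → ℕ} (hn : LeDeg n x.degree) :
    IsPrefix (x.path 0 n zero_le hn) x := by
  have e := x.deg_path_zero zero_le hn
  exact ⟨e.symm ▸ hn, x.path_congr rfl e _ _⟩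

theorem IsPrefix.of_isComp {α β τ : Λ.Path} (h : IsPrefix τ x) (hc : IsComp α β τ) :
    IsPrefix α x := by
  have hle : deg α ≤ deg τ := hc.deg_eq ▸ le_self_add
  refine ⟨h.1.of_le hle, ?_⟩
  have h1 := x.isComp_path zero_le hle h.1
  rw [h.2] at h1
  exact (h1.cancel hc (x.deg_path_zero _ _)).1

theorem IsPrefix.range_eq {lam : Λ.Path} (h : IsPrefix lam x) : x.r = lam.r := by
  rw [← h.2, path_range]

theorem shift_r (x : Λ.BoundaryPath) {m : Fin k → ℕ} (hm : LeDeg m x.degree) :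
    (x.shift m hm).r = (x.path 0 m zero_le hm).s := by
  rw [x.path_s]
  simp only [r, shift]
  congr 1
  exact zero_add m

theorem isPrefix_shift_iff {α β τ : Λ.Path} (hc : IsComp α β τ) (hα : IsPrefix α x) :
    IsPrefix β (x.shift (deg α) hα.1) ↔ IsPrefix τ x := by
  constructor
  · rintro ⟨h1, h2⟩
    have h3 := hα.1.add_of_sub h1
    have e : deg β + deg α = deg τ := by rw [hc.deg_eq, add_comm]
    have h4 : LeDeg (deg τ) x.degree := e ▸ h3
    refine ⟨h4, ?_⟩
    have hle : deg α ≤ deg τ := e ▸ le_add_self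
    have h5 := x.isComp_path zero_le hle h4
    rw [hα.2] at h5
    rw [shift_path, x.path_congr (zero_add _) e] at h2
    rw [h2] at h5
    exact h5.unique hc
  · rintro ⟨h1, h2⟩
    have e : deg β + deg α = deg τ := by rw [hc.deg_eq, add_comm]
    have hle : deg α ≤ deg τ := e ▸ le_add_self
    have h5 := x.isComp_path zero_le hle h1
    rw [h2, hα.2] at h5
    have hs : LeDeg (deg β) (x.shift (deg α) hα.1).degree := LeDeg.sub (e ▸ h1)
    refine ⟨hs, ?_⟩
    rw [shift_path, x.path_congr (zero_add _) e]
    exact (h5.cancel hc rfl).2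

theorem mem_cylinder_iff {lam : Λ.Path} : x ∈ cylinder lam ↔ IsPrefix lam x := by
  constructor
  · rintro ⟨y, -, h, -, e⟩
    exact ⟨h, e⟩
  · intro h
    refine ⟨x.shift _ h.1, ?_, h.1, rfl, h.2⟩
    rw [shift_r, h.2]

theorem IsPrefix.exists_minExt {α β : Λ.Path} (hα : IsPrefix α x) (hβ : IsPrefix β x) :
    ∃ p ∈ minExt α β, ∃ τ, IsComp α p.1 τ ∧ IsComp β p.2 τ ∧ IsPrefix τ x := by
  have hle : LeDeg (deg α ⊔ deg β) x.degree := hα.1.sup hβ.1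
  have h1 := x.isComp_path zero_le (le_sup_left : deg α ≤ deg α ⊔ deg β) hle
  have h2 := x.isComp_path zero_le (le_sup_right : deg β ≤ deg α ⊔ deg β) hle
  rw [hα.2] at h1
  rw [hβ.2] at h2
  obtain ⟨p, hp, τ, γ, h3, h4, h5, -⟩ := HigherRankGraph.exists_minExt h1 h2
  exact ⟨p, hp, τ, h3, h4, (x.isPrefix_path hle).of_isComp h5⟩

/-- A boundary path extending `α` extends `αε` for some `ε` in any finite exhaustive set. -/
theorem IsPrefix.exists_of_exhaustive {α : Λ.Path} (hα : IsPrefix α x) {E : Set Λ.Path}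
    (hE : E.Finite) (hex : Exhaustive α.s E) : ∃ ε ∈ E, ∃ τ, IsComp α ε τ ∧ IsPrefix τ x := by
  have hv : x.vertex (deg α) hα.1 = α.s := by
    rw [← x.path_s 0 (deg α) zero_le hα.1, hα.2]
  obtain ⟨ε, hε, h, e⟩ := x.boundary (deg α) hα.1 E hE (hv ▸ hex)
  have h1 := x.isComp_path zero_le (le_self_add : deg α ≤ deg α + deg ε) h
  rw [e, hα.2] at h1
  exact ⟨ε, hε, _, h1, x.isPrefix_path h⟩

/-! ### Concatenation of a path and a boundary path -/

/-- The product `lam x` exists whenever `r(x) = s(lam)`. -/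
theorem exists_isConcat (fa : Λ.FinitelyAligned) {lam : Λ.Path} (hx : x.r = lam.s) :
    ∃ y, IsConcat lam x y := by
  -- With T(q) = lam x(0, q - d(lam)), truncated subtraction, the degree of T(q) is at least q in
  -- every coordinate. The initial segment P(q) of T(q) of degree q will be y(0,q).
  let D : Fin k → ℕ∞ := fun i => deg lam i + x.degree i
  have hsub : ∀ {q}, LeDeg q D → LeDeg (q - deg lam) x.degree := by
    intro q hq i
    simpa [D, add_comm] using hq i
  have hadd : ∀ {q}, LeDeg q x.degree → LeDeg (q + deg lam) D := by
    intro q hq i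
    simpa [D, add_comm] using add_le_add_left (hq i) (deg lam i : ℕ∞)
  have hT : ∀ q (hq : LeDeg q D), ∃ τ, IsComp lam (x.path 0 (q - deg lam) zero_le (hsub hq)) τ :=
    fun q hq => exists_isComp (by rw [path_range, hx])
  choose T hT using hT
  have hTdeg : ∀ q hq, deg (T q hq) = deg lam + (q - deg lam) := by
    intro q hq
    rw [(hT q hq).deg_eq, deg_path_zero]
  have hP : ∀ q (hq : LeDeg q D), ∃ α β, IsComp α β (T q hq) ∧ deg α = q :=
    fun q hq => exists_factor _ (by rw [hTdeg]; exact le_add_tsub)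
  choose P R hP hPdeg using hP
  have hPT : ∀ q hq, deg lam ≤ q → P q hq = T q hq := by
    intro q hq hle
    refine (hP q hq).eq_of_deg_right ?_
    have h1 := (hP q hq).deg_eq
    rw [hTdeg, hPdeg, add_tsub_cancel_of_le hle] at h1
    exact left_eq_add.1 h1
  have hTmono : ∀ p q (h : p ≤ q) (hq : LeDeg q D), IsComp (T p (hq.of_le h))
      (x.path (p - deg lam) (q - deg lam) (tsub_le_tsub_right h _) (hsub hq)) (T q hq) := by
    intro p q h hq
    have h1 := x.isComp_path zero_le (tsub_le_tsub_right h (deg lam)) (hsub hq)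
    obtain ⟨τ, h2, h3⟩ := h1.assoc_symm (hT q hq)
    rwa [← (hT p (hq.of_le h)).unique h2] at h3
  have hmono : ∀ p q (h : p ≤ q) (hq : LeDeg q D),
      ∃ ν, IsComp (P p (hq.of_le h)) ν (P q hq) := by
    intro p q h hq
    obtain ⟨ε, -, h1⟩ := (hP p (hq.of_le h)).assoc (hTmono p q h hq)
    obtain ⟨ν, hν, -⟩ := h1.factor (hP q hq) (by rwa [hPdeg, hPdeg])
    exact ⟨ν, hν⟩
  obtain ⟨y, hyd, hyp⟩ := exists_of_prefixes D P hPdeg hmono (by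
    intro n hn E hE hex
    -- The vertex of y at n need not lie on x. Moving E along μ = y(n, n ∨ d(lam)) gives a finite
    -- exhaustive set at a vertex of x, where the boundary condition of x applies; the ρ found there
    -- satisfies μρ = εσ with ε in E, so y(0,n)ε is an initial segment of y.
    have hN : LeDeg (n ⊔ deg lam) D := hn.sup fun i => by simp [D]
    obtain ⟨μ, hμ⟩ := hmono n _ le_sup_left hN
    have hex' := exhaustive_ext (μ := μ) (hμ.1 ▸ hex)
    have hs : μ.s = (x.path 0 (n ⊔ deg lam - deg lam) zero_le (hsub hN)).s := by
      rw [← hμ.source_eq, hPT _ _ le_sup_right, (hT _ _).source_eq]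
    rw [hs] at hex'
    obtain ⟨ρ, hρ, τ, h1, h2⟩ :=
      (x.isPrefix_path (hsub hN)).exists_of_exhaustive (finite_ext fa μ hE) hex'
    obtain ⟨ε, hε, σ, h3⟩ := mem_ext.1 hρ
    obtain ⟨η, h4, h5⟩ := isComp_of_mem_minExt h3
    have hM := hadd h2.1
    have hle : deg lam ≤ deg τ + deg lam := le_add_self
    have hsubM : deg τ + deg lam - deg lam = deg τ := add_tsub_cancel_right _ _
    have h6 := hT _ hM
    rw [x.path_congr rfl hsubM, h2.2, ← hPT _ _ hle] at h6
    obtain ⟨ω, h7, h8⟩ := h1.assoc_symm h6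
    obtain rfl := (hT _ hN).unique h7
    rw [← hPT _ _ le_sup_right] at h8
    obtain ⟨η', h9, h10⟩ := hμ.assoc h8
    obtain rfl := h9.unique h4
    obtain ⟨ω', h11, h12⟩ := h5.assoc_symm h10
    have e : deg ω' = n + deg ε := by rw [h11.deg_eq, hPdeg]
    have hle' : n + deg ε ≤ deg τ + deg lam := by
      have := h12.deg_eq
      rw [hPdeg, e] at this
      exact this ▸ le_self_add
    refine ⟨ε, hε, hM.of_le hle', ?_⟩
    obtain ⟨ν, hν⟩ := hmono _ _ hle' hM
    obtain ⟨rfl, -⟩ := h12.cancel hν (by rw [e, hPdeg])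
    exact h11)
  have hld : LeDeg (deg lam) D := fun i => by simp [D]
  have hPl : P _ hld = lam := by
    rw [hPT _ _ le_rfl]
    refine ((hT _ hld).eq_of_deg_right ?_).symm
    rw [deg_path_zero, tsub_self]
  have hl : LeDeg (deg lam) y.degree := hyd ▸ hld
  have hpre : y.path 0 (deg lam) zero_le hl = lam := by rw [hyp _ _ hld, hPl]
  refine ⟨y, hl, ?_, hpre⟩
  refine ext_path ?_ ?_
  · funext i
    simp only [shift, hyd, D]
    exact (ENat.addLECancellable_of_ne_top (ENat.natCast_ne_top _)).add_tsub_cancel_left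
  · intro q h1 h2
    have h3 : LeDeg (q + deg lam) y.degree := hyd ▸ hadd h2
    have hle : deg lam ≤ q + deg lam := le_add_self
    have h4 := y.isComp_path zero_le hle h3
    rw [hpre, hyp _ _ (hadd h2), hPT _ _ hle] at h4
    rw [shift_path, y.path_congr (zero_add _) rfl]
    have h5 := hT _ (hadd h2)
    rw [x.path_congr rfl (add_tsub_cancel_right q (deg lam))] at h5
    exact (h4.cancel h5 rfl).2

theorem IsConcat.isPrefix {lam : Λ.Path} (h : IsConcat lam x y) : IsPrefix lam y := ⟨h.1, h.2.2⟩

theorem IsConcat.isPrefix_iff {α β τ : Λ.Path} (h : IsConcat α x y) (hc : IsComp α β τ) :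
    IsPrefix τ y ↔ IsPrefix β x := by
  rw [← isPrefix_shift_iff hc h.isPrefix, h.2.1]

/-! ### The topology: clopen cylinders and basic neighbourhoods -/

theorem not_exhaustive_empty (a : Λ.V) : ¬ Exhaustive a (∅ : Set Λ.Path) := by
  intro h
  obtain ⟨μ, hμ, -⟩ := h.2 (CatPath.id a) rfl
  exact hμ

theorem isOpen_setOf_isPrefix (lam : Λ.Path) : IsOpen {x | IsPrefix lam x} := by
  refine TopologicalSpace.isOpen_generateFrom_of_mem
    ⟨lam, ∅, Set.finite_empty, by simp, not_exhaustive_empty _, ?_⟩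
  ext x
  simp [cylinderDiff, mem_cylinder_iff]

theorem isPrefix_id (x : Λ.BoundaryPath) : IsPrefix (CatPath.id x.r) x := by
  have h0 : LeDeg 0 x.degree := fun _ => by simp
  have := x.isPrefix_path h0
  rwa [x.path_id] at this

/-- If lam starts at r(x) and is not an initial segment of x, the boundary condition shows that
{lam} is not exhaustive. Hence removing Z(lam) from Z(r(x)) leaves one of the generating open sets.
-/
theorem isOpen_setOf_not_isPrefix (lam : Λ.Path) : IsOpen {x | ¬ IsPrefix lam x} := by
  rw [isOpen_iff_forall_mem_open]
  intro x hx
  by_cases hr : lam.r = x.r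
  · have hne : ¬ Exhaustive (CatPath.id x.r : Λ.Path).s {lam} := by
      intro hex
      obtain ⟨ε, rfl, τ, h1, h2⟩ :=
        x.isPrefix_id.exists_of_exhaustive (Set.finite_singleton lam) hex
      exact hx (h1.eq_of_deg_left (deg_id _) ▸ h2)
    have hmem : ∀ y, y ∈ cylinderDiff (CatPath.id x.r) {lam} ↔
        IsPrefix (CatPath.id x.r) y ∧ ¬ IsPrefix lam y := by
      intro y
      have hc : ∀ h : (CatPath.id x.r : Λ.Path).s = lam.r, (CatPath.id x.r).comp lam h = lam :=
        fun h => (IsComp.eq_of_deg_left ⟨h, rfl⟩ (deg_id _)).symm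
      have h0 : (CatPath.id x.r : Λ.Path).s = lam.r := hr.symm
      simp [cylinderDiff, mem_cylinder_iff, hc, h0]
    refine ⟨cylinderDiff (CatPath.id x.r) {lam}, fun y hy => ((hmem y).1 hy).2,
      TopologicalSpace.isOpen_generateFrom_of_mem
        ⟨_, _, Set.finite_singleton lam, fun ν hν => (congrArg _ hν).trans hr, hne, rfl⟩,
      (hmem x).2 ⟨x.isPrefix_id, hx⟩⟩
  · refine ⟨_, fun y hy hl => hr ?_, isOpen_setOf_isPrefix (CatPath.id x.r), x.isPrefix_id⟩
    exact hl.range_eq.symm.trans (IsPrefix.range_eq hy)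

theorem mem_cylinderDiff_iff {lam : Λ.Path} {G : Set Λ.Path} :
    x ∈ cylinderDiff lam G ↔ IsPrefix lam x ∧ ∀ ν ∈ G, ∀ τ, IsComp lam ν τ → ¬ IsPrefix τ x := by
  simp only [cylinderDiff, Set.mem_sdiff, mem_cylinder_iff, Set.mem_iUnion, not_exists, IsComp]
  refine and_congr_right fun _ => ⟨?_, ?_⟩
  · rintro h ν hν τ ⟨h1, rfl⟩
    exact h ν hν h1
  · intro h ν hν h1
    exact h ν hν _ ⟨h1, rfl⟩

theorem finite_isComp (lam : Λ.Path) {G : Set Λ.Path} (hG : G.Finite) :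
    {τ | ∃ ν ∈ G, IsComp lam ν τ}.Finite := by
  have : {τ | ∃ ν ∈ G, IsComp lam ν τ} = ⋃ ν ∈ G, {τ | IsComp lam ν τ} := by
    ext; simp
  rw [this]
  exact hG.biUnion fun ν _ => Set.Subsingleton.finite fun _ h₁ _ h₂ => IsComp.unique h₁ h₂

/-- A map whose compositions with membership in cylinder sets are locally constant at a point is
continuous there. -/
theorem tendsto_of_isPrefix {X : Type*} {l : Filter X} {φ : X → Λ.BoundaryPath}
    (h1 : ∀ lam, IsPrefix lam y → ∀ᶠ z in l, IsPrefix lam (φ z))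
    (h2 : ∀ lam, ¬ IsPrefix lam y → ∀ᶠ z in l, ¬ IsPrefix lam (φ z)) :
    Filter.Tendsto φ l (nhds y) := by
  rw [TopologicalSpace.tendsto_nhds_generateFrom_iff]
  rintro _ ⟨lam, G, hG, -, -, rfl⟩ hy
  rw [mem_cylinderDiff_iff] at hy
  have h3 : ∀ᶠ z in l, ∀ τ ∈ {τ | ∃ ν ∈ G, IsComp lam ν τ}, ¬ IsPrefix τ (φ z) := by
    rw [Filter.eventually_all_finite (finite_isComp lam hG)]
    rintro τ ⟨ν, hν, hτ⟩
    exact h2 τ (hy.2 ν hν τ hτ)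
  filter_upwards [h1 lam hy.1, h3] with z hz1 hz2
  exact mem_cylinderDiff_iff.2 ⟨hz1, fun ν hν τ hτ => hz2 τ ⟨ν, hν, hτ⟩⟩

/-- Every neighbourhood of `y` contains a set described by one initial segment of `y` and finitely
many paths that are not initial segments of `y`. -/
theorem exists_basic_subset {U : Set Λ.BoundaryPath} (hU : IsOpen U) (hy : y ∈ U) :
    ∃ (n : Fin k → ℕ) (hn : LeDeg n y.degree) (F : Set Λ.Path), F.Finite ∧
      (∀ ν ∈ F, ¬ IsPrefix ν y) ∧
      ∀ z, IsPrefix (y.path 0 n zero_le hn) z → (∀ ν ∈ F, ¬ IsPrefix ν z) → z ∈ U := by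
  induction hU with
  | basic s hs =>
    obtain ⟨lam, G, hG, -, -, rfl⟩ := hs
    rw [mem_cylinderDiff_iff] at hy
    refine ⟨_, hy.1.1, _, finite_isComp lam hG, ?_, ?_⟩
    · rintro τ ⟨ν, hν, hτ⟩
      exact hy.2 ν hν τ hτ
    · intro z hz hF
      rw [hy.1.2] at hz
      exact mem_cylinderDiff_iff.2 ⟨hz, fun ν hν τ hτ => hF τ ⟨ν, hν, hτ⟩⟩
  | univ => exact ⟨0, fun _ => by simp, ∅, Set.finite_empty, by simp, by simp⟩
  | inter s t _ _ ihs iht =>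
    obtain ⟨m, hm, F, hF, hF1, hF2⟩ := ihs hy.1
    obtain ⟨n, hn, G, hG, hG1, hG2⟩ := iht hy.2
    refine ⟨m ⊔ n, hm.sup hn, F ∪ G, hF.union hG, ?_, ?_⟩
    · rintro ν (hν | hν)
      exacts [hF1 ν hν, hG1 ν hν]
    · intro z hz hFG
      exact ⟨hF2 z (hz.of_isComp (y.isComp_path zero_le le_sup_left _))
          fun ν hν => hFG ν (Or.inl hν),
        hG2 z (hz.of_isComp (y.isComp_path zero_le le_sup_right _))
          fun ν hν => hFG ν (Or.inr hν)⟩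
  | sUnion S _ ih =>
    obtain ⟨s, hs, hys⟩ := hy
    obtain ⟨n, hn, F, hF, hF1, hF2⟩ := ih s hs hys
    exact ⟨n, hn, F, hF, hF1, fun z h1 h2 => ⟨s, hs, hF2 z h1 h2⟩⟩

/-- Every nonempty open set contains a cylinder set. -/
theorem exists_cylinder_subset (fa : Λ.FinitelyAligned) {U : Set Λ.BoundaryPath} (hU : IsOpen U)
    (hy : y ∈ U) : ∃ lam : Λ.Path, ∀ z, IsPrefix lam z → z ∈ U := by
  obtain ⟨n, hn, F, hF, hF1, hF2⟩ := exists_basic_subset hU hy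
  have hp := y.isPrefix_path hn
  set lam := y.path 0 n zero_le hn
  -- Otherwise y would extend some lam ρ with ρ in `ext lam F`, hence an element of F.
  -- Non-exhaustiveness supplies κ having no common extension with any such ρ, and Z(lam κ) then
  -- avoids F.
  have hne : ¬ Exhaustive lam.s (ext lam F) := by
    intro hex
    obtain ⟨ε, hε, τ, h1, h2⟩ := hp.exists_of_exhaustive (finite_ext fa lam hF) hex
    obtain ⟨ν, hν, σ, h3⟩ := mem_ext.1 hε
    obtain ⟨τ', h4, h5⟩ := isComp_of_mem_minExt h3
    obtain rfl := h1.unique h4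
    exact hF1 ν hν (h2.of_isComp h5)
  have : ∃ κ : Λ.Path, κ.r = lam.s ∧ ∀ ρ ∈ ext lam F, ¬ (minExt κ ρ).Nonempty := by
    by_contra! hcon
    exact hne ⟨fun ρ hρ => range_of_mem_ext hρ, hcon⟩
  obtain ⟨κ, hκ, hκ'⟩ := this
  obtain ⟨ω, hω⟩ := exists_isComp hκ.symm
  refine ⟨ω, fun z hz => hF2 z (hz.of_isComp hω) fun ν hν hνz => ?_⟩
  have hlz := hz.of_isComp hω
  obtain ⟨p, hp, τ, h1, h2, h3⟩ := hlz.exists_minExt hνz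
  have h4 := (isPrefix_shift_iff hω hlz).2 hz
  have h5 := (isPrefix_shift_iff h1 hlz).2 h3
  obtain ⟨q, hq, -⟩ := h4.exists_minExt h5
  exact hκ' p.1 (mem_ext.2 ⟨ν, hν, p.2, hp⟩) ⟨q, hq⟩

/-! ### Shifts near a point: aperiodicity and exchange of initial segments -/

theorem shift_congr (x : Λ.BoundaryPath) {m n : Fin k → ℕ} (h : m = n) (hm : LeDeg m x.degree) :
    x.shift m hm = x.shift n (h ▸ hm) := by
  subst h; rfl

theorem IsPrefix.isConcat_shift {α : Λ.Path} (h : IsPrefix α z) {a : Fin k → ℕ} (ha : deg α = a)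
    (hz : LeDeg a z.degree) : IsConcat α (z.shift a hz) z := by
  subst ha
  exact ⟨hz, rfl, h.2⟩

theorem IsConcat.shift {α β τ : Λ.Path} (h : IsConcat τ x z) (hc : IsComp α β τ)
    {a : Fin k → ℕ} (ha : deg α = a) (hz : LeDeg a z.degree) : IsConcat β x (z.shift a hz) := by
  subst ha
  have hα := h.isPrefix.of_isComp hc
  obtain ⟨h1, h2⟩ := (isPrefix_shift_iff hc hα).2 h.isPrefix
  refine ⟨h1, ?_, h2⟩
  have h3 : LeDeg (deg α + deg β) z.degree := hc.deg_eq ▸ h.1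
  rw [shift_shift z _ h1 h3, z.shift_congr hc.deg_eq.symm h3]
  exact h.2.1

/-- In an aperiodic graph, two different shifts do not agree on a nonempty open set. -/
theorem eq_of_forall_shift_eq (fa : Λ.FinitelyAligned) (ap : Λ.Aperiodic)
    {U : Set Λ.BoundaryPath} (hU : IsOpen U) (hy : y ∈ U) {m n : Fin k → ℕ}
    (h : ∀ z ∈ U, ∃ (hm : LeDeg m z.degree) (hn : LeDeg n z.degree),
      z.shift m hm = z.shift n hn) : m = n := by
  obtain ⟨lam, hlam⟩ := exists_cylinder_subset fa hU hy
  -- This auxiliary point of Z(lam) lies in U, so its degree dominates m and n. It serves only to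
  -- extend lam to a path μ of degree at least m ∨ n.
  obtain ⟨x₀, hx₀, -⟩ := ap lam.s
  obtain ⟨z₀, hz₀⟩ := exists_isConcat fa hx₀
  obtain ⟨hm₀, hn₀, -⟩ := h z₀ (hlam z₀ hz₀.isPrefix)
  have hN := hz₀.1.sup (hm₀.sup hn₀)
  have hμ := z₀.isComp_path zero_le (le_sup_left : deg lam ≤ deg lam ⊔ (m ⊔ n)) hN
  have hd := z₀.deg_path_zero zero_le hN
  rw [hz₀.2.2] at hμ
  set μ := z₀.path 0 (deg lam ⊔ (m ⊔ n)) zero_le hN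
  obtain ⟨x, hx, hap⟩ := ap μ.s
  obtain ⟨z, hz⟩ := exists_isConcat fa hx
  obtain ⟨hm, hn, e⟩ := h z (hlam z (hz.isPrefix.of_isComp hμ))
  obtain ⟨α, β, hc, hα⟩ := exists_factor μ (m := m) (by
    rw [hd]; exact le_sup_left.trans le_sup_right)
  obtain ⟨α', β', hc', hα'⟩ := exists_factor μ (m := n) (by
    rw [hd]; exact le_sup_right.trans le_sup_right)
  -- For z = μx with μ = αβ = α'β', the two shifts are βx and β'x. The choice of x at s(μ) turns
  -- their equality into β = β', and comparing degrees in μ gives m = n.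
  have hβ : β = β' := by
    by_contra hne
    exact hap β β' hc.source_eq.symm hc'.source_eq.symm hne _ _ (hz.shift hc hα hm)
      (hz.shift hc' hα' hn) e
  subst hβ
  rw [← hα, ← hα']
  exact add_right_cancel (hc.deg_eq.symm.trans hc'.deg_eq)

/-- If `σ^a(y) = σ^b(y)`, then there is a map `φ` that is continuous at `y`, fixes `y` in the limit
and satisfies `σ^b(φ(z)) = σ^a(z)` near `y`. -/
theorem exists_tendsto_shift_eq (fa : Λ.FinitelyAligned) {a b : Fin k → ℕ}
    {ha : LeDeg a y.degree} {hb : LeDeg b y.degree} (hab : y.shift a ha = y.shift b hb) :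
    ∃ φ : Λ.BoundaryPath → Λ.BoundaryPath, Filter.Tendsto φ (nhds y) (nhds y) ∧
      ∀ᶠ z in nhds y, ∃ (hz : LeDeg a z.degree) (hw : LeDeg b (φ z).degree),
        z.shift a hz = (φ z).shift b hw := by
  have hαy := y.isPrefix_path ha
  have hβy := y.isPrefix_path hb
  have hα := y.deg_path_zero zero_le ha
  have hβ := y.deg_path_zero zero_le hb
  have hs : (y.path 0 a zero_le ha).s = (y.path 0 b zero_le hb).s := by
    rw [← shift_r, ← shift_r, hab]
  set α := y.path 0 a zero_le ha
  set β := y.path 0 b zero_le hb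
  have hyα := hαy.isConcat_shift hα ha
  have hyβ := hβy.isConcat_shift hβ hb
  rw [← hab] at hyβ
  -- The map sends αu to βu; its value outside Z(α), a neighbourhood of y, is irrelevant.
  have hex : ∀ z, ∃ w, IsPrefix α z → ∃ u, IsConcat α u z ∧ IsConcat β u w := by
    intro z
    by_cases hz : IsPrefix α z
    · obtain ⟨w, hw⟩ := exists_isConcat fa (x := z.shift _ hz.1) (lam := β)
        (by rw [shift_r, hz.2, hs])
      exact ⟨w, fun _ => ⟨_, hz.isConcat_shift rfl hz.1, hw⟩⟩
    · exact ⟨z, fun h => absurd h hz⟩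
  choose φ hφ using hex
  have hαev : ∀ᶠ z in nhds y, IsPrefix α z := (isOpen_setOf_isPrefix α).eventually_mem hαy
  refine ⟨φ, tendsto_of_isPrefix ?_ ?_, ?_⟩
  · intro lam hlam
    obtain ⟨p, -, τ, h1, h2, h3⟩ := hβy.exists_minExt hlam
    obtain ⟨τ', h4⟩ := exists_isComp (hs.trans h1.1)
    have h5 : IsPrefix τ' y := (hyα.isPrefix_iff h4).2 ((hyβ.isPrefix_iff h1).1 h3)
    filter_upwards [(isOpen_setOf_isPrefix τ').eventually_mem h5] with z hz
    obtain ⟨u, hu, hu'⟩ := hφ z (IsPrefix.of_isComp hz h4)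
    exact ((hu'.isPrefix_iff h1).2 ((hu.isPrefix_iff h4).1 hz)).of_isComp h2
  · intro lam hlam
    -- The point βu extends lam only if u extends some ρ in `ext β {lam}`. By finite alignment, only
    -- finitely many cylinders Z(αρ) must be avoided.
    have hfin := finite_isComp α (finite_ext fa β (Set.finite_singleton lam))
    have hev : ∀ᶠ z in nhds y, ∀ τ ∈ {τ | ∃ ν ∈ ext β {lam}, IsComp α ν τ}, ¬ IsPrefix τ z := by
      rw [Filter.eventually_all_finite hfin]
      rintro τ ⟨ρ, hρ, hc⟩
      refine (isOpen_setOf_not_isPrefix τ).eventually_mem fun hτ => hlam ?_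
      obtain ⟨_, rfl, σ, hσ⟩ := mem_ext.1 hρ
      obtain ⟨τ', h1, h2⟩ := isComp_of_mem_minExt hσ
      exact ((hyβ.isPrefix_iff h1).2 ((hyα.isPrefix_iff hc).1 hτ)).of_isComp h2
    filter_upwards [hαev, hev] with z hz hz' hlz
    obtain ⟨u, hu, hu'⟩ := hφ z hz
    obtain ⟨p, hp, τ, h1, -, h3⟩ := hu'.isPrefix.exists_minExt hlz
    obtain ⟨τ', h4⟩ := exists_isComp (hs.trans h1.1)
    exact hz' τ' ⟨p.1, mem_ext.2 ⟨lam, rfl, p.2, hp⟩, h4⟩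
      ((hu.isPrefix_iff h4).2 ((hu'.isPrefix_iff h1).1 h3))
  · filter_upwards [hαev] with z hz
    obtain ⟨u, hu, hu'⟩ := hφ z hz
    have h1 : LeDeg a z.degree := hα ▸ hu.1
    have h2 : LeDeg b (φ z).degree := hβ ▸ hu'.1
    refine ⟨h1, h2, ?_⟩
    rw [z.shift_congr hα.symm h1, (φ z).shift_congr hβ.symm h2, hu.2.1, hu'.2.1]

/-! ### Equality of shifts with recorded exponents -/

/-- `σ^m(x) = σ^n(y)`. -/
def ShiftEq (m n : Fin k → ℕ) (x y : Λ.BoundaryPath) : Prop :=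
  ∃ (hm : LeDeg m x.degree) (hn : LeDeg n y.degree), x.shift m hm = y.shift n hn

namespace ShiftEq

variable {m n t a b c d : Fin k → ℕ}

theorem symm (h : ShiftEq m n x y) : ShiftEq n m y x := by
  obtain ⟨hm, hn, e⟩ := h
  exact ⟨hn, hm, e.symm⟩

theorem add (h : ShiftEq m n x y) (ht : LeDeg (n + t) y.degree) :
    ShiftEq (m + t) (n + t) x y := by
  obtain ⟨hm, hn, e⟩ := h
  have h1 : LeDeg t (y.shift n hn).degree := LeDeg.sub (add_comm n t ▸ ht)
  have h2 : LeDeg t (x.shift m hm).degree := e ▸ h1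
  have h3 : LeDeg (m + t) x.degree := add_comm t m ▸ hm.add_of_sub h2
  refine ⟨h3, ht, ?_⟩
  rw [← shift_shift x hm h2 h3, ← shift_shift y hn h1 ht]
  congr 1

/-- Shifting both relations further until the exponent at z is b ∨ d eliminates z. Each correction
preserves the difference of the two exponents of its relation. -/
theorem join (h : ShiftEq a b x z) (h' : ShiftEq c d y z) :
    ShiftEq (a + (b ⊔ d - b)) (c + (b ⊔ d - d)) x y := by
  have hbd : LeDeg (b ⊔ d) z.degree := h.2.1.sup h'.2.1
  have e1 : b + (b ⊔ d - b) = b ⊔ d := add_tsub_cancel_of_le le_sup_left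
  have e2 : d + (b ⊔ d - d) = b ⊔ d := add_tsub_cancel_of_le le_sup_right
  obtain ⟨h1, h2, h3⟩ := h.add (t := b ⊔ d - b) (e1.symm ▸ hbd)
  obtain ⟨h4, h5, h6⟩ := h'.add (t := b ⊔ d - d) (e2.symm ▸ hbd)
  refine ⟨h1, h4, h3.trans (Eq.trans ?_ h6.symm)⟩
  exact z.shift_congr (e1.trans e2.symm) _

end ShiftEq

end BoundaryPath

/-! ### Cocycles and periods -/

open BoundaryPath

variable {k₁ k₂ : ℕ} {Λ₁ : HigherRankGraph.{u₁, v₁} k₁} {Λ₂ : HigherRankGraph.{u₂, v₂} k₂}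
  {h : Λ₁.BoundaryPath ≃ₜ Λ₂.BoundaryPath}
  {f g : ∀ m : Fin k₁ → ℕ, Λ₁.BoundaryPathGE m → (Fin k₂ → ℕ)}

/-- The relation `σ^m(x) = σ^n(y)` is carried by `h` to a relation between shifts of `h(x)` and
`h(y)`, with exponents given by the cocycles. -/
theorem IsCocyclePair.shiftEq (hfg : IsCocyclePair h f g) {m n : Fin k₁ → ℕ}
    {x y : Λ₁.BoundaryPath} (hm : LeDeg m x.degree) (hn : LeDeg n y.degree)
    (e : x.shift m hm = y.shift n hn) :
    ShiftEq (g m ⟨x, hm⟩ + (f m ⟨x, hm⟩ ⊔ f n ⟨y, hn⟩ - f m ⟨x, hm⟩))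
      (g n ⟨y, hn⟩ + (f m ⟨x, hm⟩ ⊔ f n ⟨y, hn⟩ - f n ⟨y, hn⟩)) (h x) (h y) := by
  have h1 : ShiftEq _ _ _ _ := hfg.orbit_eq m ⟨x, hm⟩
  have h2 : ShiftEq _ _ _ _ := hfg.orbit_eq n ⟨y, hn⟩
  dsimp only at h1 h2
  rw [← e] at h2
  exact h1.symm.join h2.symm

/-- A continuous map to `ℕ^k` on `∂Λ^{≥ m}` is locally constant. -/
theorem eventually_eq_of_continuous {m : Fin k₁ → ℕ} {F : Λ₁.BoundaryPathGE m → (Fin k₂ → ℕ)}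
    (hF : Continuous F) {x : Λ₁.BoundaryPath} (hx : LeDeg m x.degree) :
    ∀ᶠ z in nhds x, ∀ hz : LeDeg m z.degree, F ⟨z, hz⟩ = F ⟨x, hx⟩ := by
  have h1 : ∀ᶠ z in nhds (⟨x, hx⟩ : Λ₁.BoundaryPathGE m), F z = F ⟨x, hx⟩ :=
    hF.continuousAt.eventually_mem ((isOpen_discrete {F ⟨x, hx⟩}).mem_nhds rfl)
  rw [nhds_subtype_eq_comap, Filter.eventually_comap] at h1
  filter_upwards [h1] with z hz hz'
  exact hz ⟨z, hz'⟩ rfl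

theorem IsCocyclePair.preservesPeriods (fa : Λ₂.FinitelyAligned) (ap : Λ₂.Aperiodic)
    {i j : ∀ m : Fin k₂ → ℕ, Λ₂.BoundaryPathGE m → (Fin k₁ → ℕ)}
    (hfg : IsCocyclePair h f g) (hij : IsCocyclePair h.symm i j) : PreservesPeriods h f g := by
  intro x
  ext l
  constructor
  · rintro ⟨m, n, hm, hn, e, rfl⟩
    obtain ⟨h1, h2, h3⟩ := hfg.shiftEq hm hn e
    refine ⟨_, _, h1, h2, h3, ?_⟩
    funext c
    -- The corrections f_m ∨ f_n - f_m and f_m ∨ f_n - f_n are true differences, so the common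
    -- supremum drops out and only the lags remain.
    simp only [lag, Pi.sub_apply, Pi.add_apply, Pi.sup_apply]
    omega
  · rintro ⟨a, b, ha, hb, e, rfl⟩
    obtain ⟨hM, hN, hMN⟩ := hij.shiftEq ha hb e
    set M := j a ⟨h x, ha⟩ + (i a ⟨h x, ha⟩ ⊔ i b ⟨h x, hb⟩ - i a ⟨h x, ha⟩)
    set N := j b ⟨h x, hb⟩ + (i a ⟨h x, ha⟩ ⊔ i b ⟨h x, hb⟩ - i b ⟨h x, hb⟩)
    rw [h.symm_apply_apply] at hM hN
    simp only [h.symm_apply_apply] at hMN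
    obtain ⟨φ, hφ, hφ'⟩ := exists_tendsto_shift_eq fa e
    have hsymm : Filter.Tendsto h.symm (nhds (h x)) (nhds x) := by
      simpa using h.symm.continuous.tendsto (h x)
    -- Round trip through h⁻¹ and h for the pair z, φ(z). All eight cocycle values are frozen at
    -- those of h(x) or x, because φ(z) tends to h(x) and h⁻¹ is continuous.
    have key : ∀ᶠ z in nhds (h x), ShiftEq
        (g M ⟨x, hM⟩ + (f M ⟨x, hM⟩ ⊔ f N ⟨x, hN⟩ - f M ⟨x, hM⟩))
        (g N ⟨x, hN⟩ + (f M ⟨x, hM⟩ ⊔ f N ⟨x, hN⟩ - f N ⟨x, hN⟩)) z (φ z) := by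
      filter_upwards [hφ', eventually_eq_of_continuous (hij.continuous_f a) ha,
        eventually_eq_of_continuous (hij.continuous_g a) ha,
        hφ.eventually (eventually_eq_of_continuous (hij.continuous_f b) hb),
        hφ.eventually (eventually_eq_of_continuous (hij.continuous_g b) hb),
        hsymm.eventually (eventually_eq_of_continuous (hfg.continuous_f M) hM),
        hsymm.eventually (eventually_eq_of_continuous (hfg.continuous_g M) hM),
        (hsymm.comp hφ).eventually (eventually_eq_of_continuous (hfg.continuous_f N) hN),
        (hsymm.comp hφ).eventually (eventually_eq_of_continuous (hfg.continuous_g N) hN)]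
        with z ⟨hz, hw, hzw⟩ hi₁ hj₁ hi₂ hj₂ hf₁ hg₁ hf₂ hg₂
      dsimp only [Function.comp_apply] at hf₂ hg₂
      have h1 := hij.shiftEq hz hw hzw
      rw [hi₁, hj₁, hi₂, hj₂] at h1
      obtain ⟨hM', hN', e'⟩ := h1
      have h2 := hfg.shiftEq hM' hN' e'
      rw [hf₁ hM', hg₁ hM', hf₂ hN', hg₂ hN'] at h2
      simpa using h2
    obtain ⟨U, hU, hUo, hxU⟩ := eventually_nhds_iff.1 (key.and hφ')
    -- Joining the round-trip relation with σ^a(z) = σ^b(φ(z)) over φ(z) relates z to itself on all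
    -- of U.
    have heq := eq_of_forall_shift_eq fa ap hUo hxU fun z hz =>
      ShiftEq.join (hU z hz).1 (hU z hz).2
    refine ⟨M, N, hM, hN, hMN, ?_⟩
    funext c
    have := congrFun heq c
    simp only [lag, Pi.sub_apply, Pi.add_apply, Pi.sup_apply] at this ⊢
    omega

end HigherRankGraph

theorem corollary3p7 {k₁ k₂ : ℕ}
    (Λ₁ : HigherRankGraph.{u₁, v₁} k₁) (Λ₂ : HigherRankGraph.{u₂, v₂} k₂)
    (fa₁ : Λ₁.FinitelyAligned) (fa₂ : Λ₂.FinitelyAligned)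
    (ap₁ : Λ₁.Aperiodic) (ap₂ : Λ₂.Aperiodic)
    (h : Λ₁.BoundaryPath ≃ₜ Λ₂.BoundaryPath)
    (hh : HigherRankGraph.IsContinuousOrbitEquivalence h) :
    HigherRankGraph.IsPeriodPreserving h := by
  obtain ⟨ho, f, g, i, j, hfg, hij⟩ := hh
  exact ⟨ho, f, g, i, j, hfg, hij, hfg.preservesPeriods fa₂ ap₂ hij,
    hij.preservesPeriods fa₁ ap₁ hfg⟩
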